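/- For $k\ge 1$ let $\mathcal O_k$ be the ring of germs at $0$ of analytic functions $\mathbb C^k\to\mathbb C$. If $Y$ is (the germ at $0$ of) an analytic subvariety of $\mathbb C^k$, let $I(Y)\subseteq\mathcal O_k$ be the ideal of germs vanishing on $Y$, and let $$\Theta_Y=\{\delta\in\mathcal O_k^k:\ \delta(I(Y))\subseteq I(Y)\},\qquad \delta(f)=\sum_{j=1}^k\delta_j\frac{\partial f}{\partial x_j}.$$ An analytic map germ $g:(\mathbb C^k,0)\to(\mathbb C^m,0)$ is called reduced if the ideal of $\mathcal O_k$ generated by its components is radical. For a linear map $p:\mathbb C^i\to\mathbb C^n$ and an analytic subvariety $X$ of $(\mathbb C^n,0)$ let $$\mathrm{Low}_X(p)=\{\theta\in\mathcal O_i^i:\ Dp\circ\theta=\eta\circ p\ \text{ for some }\eta\in\Theta_X\}.$$ Let $n\ge 2$ and $1\le i\le n-1$. Let $h:(\mathbb C^n,0)\to(\mathbb C^m,0)$ be a reduced analytic map germ, let $X=h^{-1}(0)$ as a germ at $0$, and let $p:\mathbb C^i\to\mathbb C^n$ be a linear map with $\pi_i\circ p=\mathrm{id}_{\mathbb C^i}$,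 where $\pi_i:\mathbb C^n\to\mathbb C^i$ is the projection onto the first $i$ coordinates. Suppose that $h\circ p:(\mathbb C^i,0)\to(\mathbb C^m,0)$ is also reduced. Then $$\mathrm{Low}_X(p)\subseteq\Theta_{p^{-1}(X)}.$$ -/

import Mathlib

open Filter Topology

namespace AnalyticGerms

/-- `𝒪 n`: the ring of germs at `0` of analytic functions `ℂⁿ → ℂ`, as a subring of the ring of
all function germs at `0`. -/
def 𝒪 (n : ℕ) : Subring (Germ (𝓝 (0 : Fin n → ℂ)) ℂ) where
  carrier := {f | ∃ F : (Fin n → ℂ) → ℂ, AnalyticAt ℂ F 0 ∧ (F : Germ (𝓝 (0 : Fin n → ℂ)) ℂ) = f}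
  mul_mem' := by
    rintro _ _ ⟨F, hF, rfl⟩ ⟨G, hG, rfl⟩
    exact ⟨F * G, hF.mul hG, rfl⟩
  one_mem' := ⟨1, analyticAt_const, rfl⟩
  add_mem' := by
    rintro _ _ ⟨F, hF, rfl⟩ ⟨G, hG, rfl⟩
    exact ⟨F + G, hF.add hG, rfl⟩
  zero_mem' := ⟨0, analyticAt_const, rfl⟩
  neg_mem' := by
    rintro _ ⟨F, hF, rfl⟩
    exact ⟨-F, hF.neg, rfl⟩

/-- The germ at `0` of a function that is analytic at `0`. -/
noncomputable def toGerm {n : ℕ} (F : (Fin n → ℂ) → ℂ) (hF : AnalyticAt ℂ F 0) : 𝒪 n :=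
  ⟨(F : Germ (𝓝 (0 : Fin n → ℂ)) ℂ), F, hF, rfl⟩

/-- The partial derivative `∂/∂x_j : 𝒪 n → 𝒪 n`. -/
noncomputable def pderiv {n : ℕ} (j : Fin n) (f : 𝒪 n) : 𝒪 n :=
  ⟨Germ.map' (fun F x => fderiv ℂ F x (Pi.single j 1))
      (fun F G (hFG : F =ᶠ[𝓝 0] G) => by
        filter_upwards [hFG.fderiv (𝕜 := ℂ)] with x hx
        simp only [hx])
      (f : Germ (𝓝 (0 : Fin n → ℂ)) ℂ), by
    obtain ⟨_, F, hF, rfl⟩ := f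
    exact ⟨fun x => fderiv ℂ F x (Pi.single j 1),
      ((ContinuousLinearMap.apply ℂ ℂ (Pi.single j 1 : Fin n → ℂ)).analyticAt _).comp hF.fderiv, rfl⟩⟩

theorem tendsto_linearMap {i n : ℕ} (p : (Fin i → ℂ) →ₗ[ℂ] (Fin n → ℂ)) :
    Tendsto p (𝓝 0) (𝓝 0) := by
  simpa using p.continuous_of_finiteDimensional.tendsto 0

theorem analyticAt_linearMap {i n : ℕ} (p : (Fin i → ℂ) →ₗ[ℂ] (Fin n → ℂ)) :
    AnalyticAt ℂ p 0 :=
  (LinearMap.toContinuousLinearMap p).analyticAt 0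

theorem analyticAt_comp_linearMap {i n m : ℕ} {h : (Fin n → ℂ) → (Fin m → ℂ)}
    (hh : AnalyticAt ℂ h 0) (p : (Fin i → ℂ) →ₗ[ℂ] (Fin n → ℂ)) :
    AnalyticAt ℂ (h ∘ p) 0 :=
  AnalyticAt.comp_of_eq hh (analyticAt_linearMap p) (map_zero p)

theorem analyticAt_component {n m : ℕ} {h : (Fin n → ℂ) → (Fin m → ℂ)}
    (hh : AnalyticAt ℂ h 0) (k : Fin m) : AnalyticAt ℂ (fun x => h x k) 0 :=
  ((ContinuousLinearMap.proj (R := ℂ) (φ := fun _ : Fin m => ℂ) k).analyticAt _).comp hh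

/-- The pull-back `f ↦ f ∘ p`, `𝒪 n → 𝒪 i`, along a linear map `p : ℂⁱ → ℂⁿ`. -/
noncomputable def pullback {i n : ℕ} (p : (Fin i → ℂ) →ₗ[ℂ] (Fin n → ℂ)) (f : 𝒪 n) : 𝒪 i :=
  ⟨(f : Germ (𝓝 (0 : Fin n → ℂ)) ℂ).compTendsto p (tendsto_linearMap p), by
    obtain ⟨_, F, hF, rfl⟩ := f
    exact ⟨F ∘ p, AnalyticAt.comp_of_eq hF (analyticAt_linearMap p) (map_zero p), rfl⟩⟩

/-- `I(X)`: the ideal of the germs in `𝒪 n` that vanish on the germ at `0` of the set `X`. -/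
def vanishingIdeal {n : ℕ} (X : Set (Fin n → ℂ)) : Ideal (𝒪 n) where
  carrier := {f | ∃ F : (Fin n → ℂ) → ℂ, (F : Germ (𝓝 (0 : Fin n → ℂ)) ℂ) = f ∧ ∀ᶠ x in 𝓝 0, x ∈ X → F x = 0}
  add_mem' := by
    rintro ⟨_, _⟩ ⟨_, _⟩ ⟨F, rfl, hF⟩ ⟨G, rfl, hG⟩
    refine ⟨F + G, rfl, ?_⟩
    filter_upwards [hF, hG] with x h1 h2 hx
    simp [h1 hx, h2 hx]
  zero_mem' := ⟨0, rfl, by simp⟩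
  smul_mem' := by
    rintro ⟨_, G, -, rfl⟩ ⟨_, _⟩ ⟨F, rfl, hF⟩
    refine ⟨G * F, rfl, ?_⟩
    filter_upwards [hF] with x h1 hx
    simp [h1 hx]

/-- The action `δ(f) = ∑ⱼ δⱼ ∂f/∂xⱼ` of a vector field germ `δ ∈ 𝒪ₙⁿ` on a germ `f ∈ 𝒪ₙ`. -/
noncomputable def applyField {n : ℕ} (δ : Fin n → 𝒪 n) (f : 𝒪 n) : 𝒪 n :=
  ∑ j, δ j * pderiv j f

/-- `Θ_X`: the `𝒪 n`-module of vector field germs `δ` with `δ(I(X)) ⊆ I(X)`. -/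
noncomputable def Theta {n : ℕ} (X : Set (Fin n → ℂ)) : Submodule (𝒪 n) (Fin n → 𝒪 n) where
  carrier := {δ | ∀ f ∈ vanishingIdeal X, applyField δ f ∈ vanishingIdeal X}
  add_mem' := by
    intro δ ε hδ hε f hf
    have : applyField (δ + ε) f = applyField δ f + applyField ε f := by
      simp [applyField, add_mul, Finset.sum_add_distrib]
    rw [this]
    exact Ideal.add_mem _ (hδ f hf) (hε f hf)
  zero_mem' := by
    intro f _
    have : applyField (0 : Fin n → 𝒪 n) f = 0 := by simp [applyField]
    rw [this]
    exact Ideal.zero_mem _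
  smul_mem' := by
    intro g δ hδ f hf
    have : applyField (g • δ) f = g * applyField δ f := by
      simp [applyField, Finset.mul_sum, mul_assoc]
    rw [this]
    exact Ideal.mul_mem_left _ _ (hδ f hf)

/-- The entry `∂p_l/∂x_j` of the differential `Dp`, as a germ. -/
noncomputable def jacobianEntry {i n : ℕ} (p : (Fin i → ℂ) →ₗ[ℂ] (Fin n → ℂ))
    (l : Fin n) (j : Fin i) : 𝒪 i :=
  pderiv j (toGerm (fun x => p x l) (analyticAt_component (analyticAt_linearMap p) l))

/-- `Low_X(p)`: the vector field germs `θ ∈ 𝒪ᵢⁱ` such that `Dp ∘ θ = η ∘ p` for some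
`η ∈ Θ_X`. -/
def Low {i n : ℕ} (X : Set (Fin n → ℂ)) (p : (Fin i → ℂ) →ₗ[ℂ] (Fin n → ℂ)) :
    Set (Fin i → 𝒪 i) :=
  {θ | ∃ η ∈ Theta X, ∀ l : Fin n, ∑ j, jacobianEntry p l j * θ j = pullback p (η l)}

/-- The projection `π_i : ℂⁿ → ℂⁱ` onto the first `i` coordinates. -/
def firstCoords {i n : ℕ} (hin : i ≤ n) : (Fin n → ℂ) →ₗ[ℂ] (Fin i → ℂ) :=
  LinearMap.funLeft ℂ ℂ (Fin.castLE hin)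

/-- `L_{i,n}`: the linear maps `p : ℂⁱ → ℂⁿ` with `π_i ∘ p = id`. -/
def linearSections {i n : ℕ} (hin : i ≤ n) : Set ((Fin i → ℂ) →ₗ[ℂ] (Fin n → ℂ)) :=
  {p | firstCoords hin ∘ₗ p = LinearMap.id}

/-- A map `h` analytic at `0` is reduced when the ideal of `𝒪 n` generated by the germs of its
components is a radical ideal. -/
def IsReducedMap {n m : ℕ} (h : (Fin n → ℂ) → (Fin m → ℂ)) (hh : AnalyticAt ℂ h 0) : Prop :=
  (Ideal.span (Set.range fun k : Fin m =>
    toGerm (fun x => h x k) (analyticAt_component hh k))).IsRadical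

end AnalyticGerms

/-! Let `θ` lift to `η`, and let `f` vanish on `p⁻¹(X)`, the zero set of `h ∘ p`. By the Rückert
Nullstellensatz a power of `f` lies in the ideal generated by the components `h_k ∘ p`; as `h ∘ p`
is reduced, `f` itself does. By the chain rule (`applyField_pullback`), `θ(h_k ∘ p) = η(h_k) ∘ p`,
which vanishes on `p⁻¹(X)` because `h_k ∈ I(X)` and `η ∈ Θ_X`. The Leibniz rule extends this from
the generators to `f`.

Most of the work is the Nullstellensatz (`mem_radical_of_eventually_vanishing`). The radical is an
intersection of primes, so it is enough that a germ outside a prime `P` is nonzero at points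
arbitrarily close to `0` where given members of `P` vanish (`hasPoints`). This goes by induction on
the dimension. After a linear change of coordinates, `P` contains a germ equal to `z ^ k` on the
first axis. `weierstrass_division` then replaces members of `P` by polynomials in `z` over functions
of the other variables, `exists_finset_eliminating` removes `z`, and a point found one dimension
lower lifts to a common root, small by `eventually_norm_root_lt`.

Weierstrass division is obtained from operators: substituting a small shift for `z` turns
multiplication by a germ into a bounded operator depending analytically on the parameters, and
division becomes the inversion of an operator equal to `1` at parameter `0`. -/

set_option maxSynthPendingDepth 3

namespace AnalyticGerms

/-! ### Power series evaluated at tuples of operators -/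

/-- The series obtained from a power series in `D` complex variables by substituting elements of a
normed algebra `A` for the variables. -/
noncomputable def substSeries {D : ℕ} (A : Type*) [NormedRing A] [NormedAlgebra ℂ A]
    (p : FormalMultilinearSeries ℂ (Fin D → ℂ) ℂ) :
    FormalMultilinearSeries ℂ (Fin D → A) A := fun n =>
  ∑ i : Fin n → Fin D, p n (fun j => Pi.single (i j) 1) •
    (ContinuousMultilinearMap.mkPiAlgebraFin ℂ n A).compContinuousLinearMap
      (fun j => ContinuousLinearMap.proj (R := ℂ) (φ := fun _ : Fin D => A) (i j))

theorem norm_proj_le_one {D : ℕ} (A : Type*) [NormedRing A] [NormedAlgebra ℂ A] (i : Fin D) :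
    ‖ContinuousLinearMap.proj (R := ℂ) (φ := fun _ : Fin D => A) i‖ ≤ 1 :=
  ContinuousLinearMap.opNorm_le_bound _ zero_le_one fun x => by
    simpa using norm_le_pi_norm x i

/-- There are `D ^ n` words of length `n`; each has a coefficient bounded by `‖p n‖` and a product
of coordinate projections of norm at most one. -/
theorem norm_substSeries_le {D : ℕ} (A : Type*) [NormedRing A] [NormedAlgebra ℂ A]
    [NormOneClass A] (p : FormalMultilinearSeries ℂ (Fin D → ℂ) ℂ) (n : ℕ) :
    ‖substSeries A p n‖ ≤ (D : ℝ) ^ n * ‖p n‖ := by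
  have key : ∀ i : Fin n → Fin D, ‖p n (fun j => Pi.single (i j) 1) •
      (ContinuousMultilinearMap.mkPiAlgebraFin ℂ n A).compContinuousLinearMap
      (fun j => ContinuousLinearMap.proj (R := ℂ) (φ := fun _ : Fin D => A) (i j))‖ ≤ ‖p n‖ := by
    intro i
    have h1 : ‖p n (fun j => Pi.single (i j) 1)‖ ≤ ‖p n‖ := by
      refine ((p n).le_opNorm _).trans ?_
      simp [Pi.norm_single]
    have h2 : ‖(ContinuousMultilinearMap.mkPiAlgebraFin ℂ n A).compContinuousLinearMap
        (fun j => ContinuousLinearMap.proj (R := ℂ) (φ := fun _ : Fin D => A) (i j))‖ ≤ 1 := by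
      refine (ContinuousMultilinearMap.norm_compContinuousLinearMap_le _ _).trans ?_
      rw [ContinuousMultilinearMap.norm_mkPiAlgebraFin, one_mul]
      exact Finset.prod_le_one (fun _ _ => norm_nonneg _) fun j _ => norm_proj_le_one A (i j)
    rw [norm_smul]
    simpa using mul_le_mul h1 h2 (norm_nonneg _) (norm_nonneg _)
  refine (norm_sum_le _ _).trans ((Finset.sum_le_sum fun i _ => key i).trans ?_)
  simp

theorem substSeries_radius_pos {D : ℕ} (A : Type*) [NormedRing A] [NormedAlgebra ℂ A]
    [NormOneClass A] (p : FormalMultilinearSeries ℂ (Fin D → ℂ) ℂ) (hp : 0 < p.radius) :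
    0 < (substSeries A p).radius := by
  obtain ⟨C, r, hC, hr, h⟩ := p.le_mul_pow_of_radius_pos hp
  -- `D + 1` rather than `D` keeps the radius meaningful when `D = 0`.
  have hr' : 0 < (D + 1) * r := by positivity
  refine lt_of_lt_of_le ?_ ((substSeries A p).le_radius_of_bound (r := ((D + 1) * r)⁻¹.toNNReal) C
    fun n => ?_)
  · simpa using inv_pos.2 hr'
  · rw [Real.coe_toNNReal _ (inv_nonneg.2 hr'.le), inv_pow, ← div_eq_mul_inv,
      div_le_iff₀ (by positivity)]
    refine (norm_substSeries_le A p n).trans ?_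
    calc (D : ℝ) ^ n * ‖p n‖ ≤ (D + 1 : ℝ) ^ n * (C * r ^ n) := by
          gcongr
          · linarith
          · exact h n
      _ = C * ((D + 1) * r) ^ n := by rw [mul_pow]; ring

theorem comp_prod_ofFn {D : ℕ} {H : Type*} [NormedAddCommGroup H] [NormedSpace ℂ H]
    (φ : H →L[ℂ] ℂ) (x : Fin D → H →L[ℂ] H) (y : Fin D → ℂ) (hxy : ∀ i, φ ∘L x i = y i • φ)
    (n : ℕ) (i : Fin n → Fin D) :
    φ ∘L (List.ofFn fun j => x (i j)).prod = (∏ j, y (i j)) • φ := by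
  induction n with
  | zero => ext; simp
  | succ n ih =>
    rw [List.ofFn_succ, List.prod_cons, Fin.prod_univ_succ, mul_smul, ← ih (fun j => i j.succ)]
    ext v
    exact DFunLike.congr_fun (hxy (i 0)) _

/-- A joint eigenfunctional turns each word in the operators into the corresponding monomial in the
eigenvalues, so the operators need not commute. -/
theorem comp_substSeries {D : ℕ} {H : Type*} [NormedAddCommGroup H] [NormedSpace ℂ H]
    (p : FormalMultilinearSeries ℂ (Fin D → ℂ) ℂ)
    (φ : H →L[ℂ] ℂ) (x : Fin D → H →L[ℂ] H) (y : Fin D → ℂ) (hxy : ∀ i, φ ∘L x i = y i • φ)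
    (n : ℕ) :
    φ ∘L (substSeries (H →L[ℂ] H) p n fun _ => x) = (p n fun _ => y) • φ := by
  have hy : (p n fun _ => y) =
      ∑ i : Fin n → Fin D, (∏ j, y (i j)) • p n (fun j => Pi.single (i j) 1) := by
    have : y = ∑ i, y i • (Pi.single i 1 : Fin D → ℂ) := by
      ext j; simp [Finset.sum_apply, Pi.single_apply]
    conv_lhs => rw [this]
    rw [(p n).map_sum]
    exact Finset.sum_congr rfl fun i _ => (p n).map_smul_univ _ _
  ext v
  rw [smul_apply, hy, Finset.sum_smul]
  simp only [substSeries, sum_apply, smul_apply,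
    ContinuousMultilinearMap.compContinuousLinearMap_apply, ContinuousLinearMap.proj_apply,
    ContinuousMultilinearMap.mkPiAlgebraFin_apply, ContinuousLinearMap.comp_apply, map_sum, map_smul]
  refine Finset.sum_congr rfl fun i _ => ?_
  have := DFunLike.congr_fun (comp_prod_ofFn φ x y hxy n i) v
  simp only [ContinuousLinearMap.comp_apply, smul_apply] at this
  rw [this, smul_smul, smul_eq_mul, smul_eq_mul, smul_eq_mul]
  ring

theorem mem_eball_of_mem_ball {E : Type*} [SeminormedAddCommGroup E] {ρ : NNReal} {x : E}
    {r : ENNReal} (hx : x ∈ Metric.ball (0 : E) ρ) (hr : (ρ : ENNReal) < r) :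
    x ∈ Metric.eball (0 : E) r := by
  rw [← Metric.eball_coe] at hx
  exact Metric.eball_subset_eball hr.le hx

/-- An analytic germ can be evaluated at small tuples of operators, compatibly with joint
eigenfunctionals. -/
theorem exists_operatorCalculus {D : ℕ} (H : Type*) [NormedAddCommGroup H] [NormedSpace ℂ H]
    [CompleteSpace H] [Nontrivial H] {F : (Fin D → ℂ) → ℂ} (hF : AnalyticAt ℂ F 0) :
    ∃ ρ > 0, ∃ Φ : (Fin D → H →L[ℂ] H) → H →L[ℂ] H, AnalyticOnNhd ℂ Φ (Metric.ball 0 ρ) ∧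
      ∀ x ∈ Metric.ball 0 ρ, ∀ y ∈ Metric.ball 0 ρ, ∀ φ : H →L[ℂ] ℂ,
        (∀ i, φ ∘L x i = y i • φ) → φ ∘L Φ x = F y • φ := by
  obtain ⟨p, R, hp⟩ := hF
  have hP := (substSeries (H →L[ℂ] H) p).hasFPowerSeriesOnBall
    (substSeries_radius_pos (H →L[ℂ] H) p (hp.r_pos.trans_le hp.r_le))
  set Φ := (substSeries (H →L[ℂ] H) p).sum
  obtain ⟨ρ, hρ, hρR⟩ : ∃ ρ : NNReal, 0 < ρ ∧
      (ρ : ENNReal) < min R (substSeries (H →L[ℂ] H) p).radius := by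
    obtain ⟨ρ, h0, h1⟩ := ENNReal.lt_iff_exists_nnreal_btwn.1 (lt_min hp.r_pos hP.r_pos)
    exact ⟨ρ, by simpa using h0, h1⟩
  refine ⟨ρ, hρ, Φ, fun x hx => hP.analyticAt_of_mem (mem_eball_of_mem_ball hx (lt_min_iff.1 hρR).2), ?_⟩
  intro x hx y hy φ hxy
  have h1 := hp.hasSum (mem_eball_of_mem_ball hy (lt_min_iff.1 hρR).1)
  have h2 := hP.hasSum (mem_eball_of_mem_ball hx (lt_min_iff.1 hρR).2)
  rw [zero_add] at h1 h2
  ext v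
  have h3 := (h2.mapL (ContinuousLinearMap.apply ℂ H v)).mapL φ
  have h4 := h1.mul_right (φ v)
  have h5 : (fun n => φ ((substSeries (H →L[ℂ] H) p n (fun _ => x)) v)) =
      fun n => (p n fun _ => y) * φ v := by
    funext n
    exact DFunLike.congr_fun (comp_substSeries p φ x y hxy n) v
  refine h3.unique ?_
  exact (congrArg (fun f => HasSum f (F y * φ v)) h5).mpr h4

/-! ### Shift operators as a model of one-variable functions -/

/-- A model of multiplication by the coordinate (`S`), of the difference quotient at `0` (`B`), of
evaluation at `0` (`ε`) and of the constant `1` (`e`) on a space of one-variable functions. -/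
structure ShiftSystem (H : Type*) [NormedAddCommGroup H] [NormedSpace ℂ H] where
  S : H →L[ℂ] H
  B : H →L[ℂ] H
  ε : H →L[ℂ] ℂ
  e : H
  B_S : ∀ v, B (S v) = v
  S_B : ∀ v, S (B v) + ε v • e = v
  B_e : B e = 0
  ε_S : ∀ v, ε (S v) = 0
  ε_e : ε e = 1
  separates : ∀ v, (∀ n : ℕ, ε ((B ^ n) v) = 0) → v = 0

namespace ShiftSystem

open scoped BoundedContinuousFunction

/-- On bounded sequences take `r` times the right shift and `r⁻¹` times the left shift. The
rescaling puts `S` inside any prescribed ball of convergence. -/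
theorem exists_norm_S_le {r : ℝ} (hr : 0 < r) : ∃ T : ShiftSystem (ℕ →ᵇ ℂ), ‖T.S‖ ≤ r := by
  let s : (ℕ →ᵇ ℂ) → ℕ → ℂ := fun v n => Nat.casesOn n 0 fun m => v m
  have hs : ∀ v n, ‖s v n‖ ≤ ‖v‖ := by
    rintro v (_ | n)
    · simp [s]
    · exact v.norm_coe_le_norm n
  let S₁ : (ℕ →ᵇ ℂ) →L[ℂ] (ℕ →ᵇ ℂ) := LinearMap.mkContinuous
    { toFun := fun v => BoundedContinuousFunction.ofNormedAddCommGroupDiscrete (s v) ‖v‖ (hs v)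
      map_add' := by intro v w; ext (_ | n) <;> simp [s]
      map_smul' := by intro c v; ext (_ | n) <;> simp [s] } 1
    (fun v => by
      rw [one_mul]
      exact (BoundedContinuousFunction.norm_le (norm_nonneg v)).2 (hs v))
  let B₁ : (ℕ →ᵇ ℂ) →L[ℂ] (ℕ →ᵇ ℂ) := LinearMap.mkContinuous
    { toFun := fun v => BoundedContinuousFunction.ofNormedAddCommGroupDiscrete
        (fun n => v (n + 1)) ‖v‖ (fun n => v.norm_coe_le_norm _)
      map_add' := by intro v w; ext n; simp
      map_smul' := by intro c v; ext n; simp } 1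
    (fun v => by
      rw [one_mul]
      exact (BoundedContinuousFunction.norm_le (norm_nonneg v)).2 fun n => v.norm_coe_le_norm _)
  have hS₁ : ∀ v n, S₁ v n = s v n := fun _ _ => rfl
  have hB₁ : ∀ v n, B₁ v n = v (n + 1) := fun _ _ => rfl
  have hr' : (r : ℂ) ≠ 0 := by exact_mod_cast hr.ne'
  have hB : ∀ (n : ℕ) v, (((r⁻¹ : ℂ) • B₁) ^ n) v 0 = (r⁻¹ : ℂ) ^ n * v n := by
    intro n
    induction n with
    | zero => simp
    | succ n ih =>
      intro v
      rw [pow_succ, mul_apply_eq_comp, ih]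
      simp only [smul_apply, BoundedContinuousFunction.coe_smul, hB₁]
      rw [smul_eq_mul, ← mul_assoc, ← pow_succ]
  refine ⟨⟨(r : ℂ) • S₁, (r⁻¹ : ℂ) • B₁, BoundedContinuousFunction.evalCLM ℂ 0,
    BoundedContinuousFunction.ofNormedAddCommGroupDiscrete
      (fun n => if n = 0 then 1 else 0) 1 (fun n => by split_ifs <;> simp), ?_, ?_, ?_, ?_, ?_, ?_⟩, ?_⟩
  · intro v
    ext n
    simp [hS₁, hB₁, s, hr']
  · intro v
    ext (_ | n) <;> simp [hS₁, hB₁, s, hr']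
  · ext n
    simp [hB₁]
  · intro v
    simp [hS₁, s]
  · simp
  · intro v hv
    ext n
    have := hv n
    simp only [BoundedContinuousFunction.evalCLM_apply, hB] at this
    simpa [hr'] using this
  · simp only [norm_smul, Complex.norm_real, Real.norm_eq_abs, abs_of_pos hr]
    exact mul_le_of_le_one_right hr.le (LinearMap.mkContinuous_norm_le _ zero_le_one _)

variable {H : Type*} [NormedAddCommGroup H] [NormedSpace ℂ H] (T : ShiftSystem H)

theorem B_pow_S_pow (k : ℕ) (v : H) : (T.B ^ k) ((T.S ^ k) v) = v := by
  induction k generalizing v with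
  | zero => simp
  | succ k ih =>
    rw [pow_succ, pow_succ', mul_apply_eq_comp, mul_apply_eq_comp, T.B_S, ih]

theorem ε_B_pow_S_pow {j k : ℕ} (hjk : j < k) (v : H) : T.ε ((T.B ^ j) ((T.S ^ k) v)) = 0 := by
  obtain ⟨l, rfl⟩ := Nat.exists_eq_add_of_lt hjk
  rw [add_assoc, pow_add, mul_apply_eq_comp, B_pow_S_pow, pow_succ',
    mul_apply_eq_comp, T.ε_S]

/-- Taylor's formula at `0` with remainder, by iterating `S_B`. -/
theorem expansion (k : ℕ) (v : H) :
    (T.S ^ k) ((T.B ^ k) v) + ∑ j ∈ Finset.range k, T.ε ((T.B ^ j) v) • (T.S ^ j) T.e = v := by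
  induction k with
  | zero => simp
  | succ k ih =>
    conv_rhs => rw [← ih, ← T.S_B ((T.B ^ k) v)]
    rw [Finset.sum_range_succ, pow_succ, pow_succ', mul_apply_eq_comp,
      mul_apply_eq_comp, map_add, map_smul]
    abel

/-- Evaluation at the point `z`. -/
noncomputable def ev (z : ℂ) : H →L[ℂ] ℂ := T.ε ∘L Ring.inverse (1 - z • T.B)

theorem ev_zero : T.ev 0 = T.ε := by
  ext v; simp [ev]

theorem ev_e {z : ℂ} (hz : IsUnit (1 - z • T.B)) : T.ev z T.e = 1 := by
  have h1 := DFunLike.congr_fun (Ring.inverse_mul_cancel _ hz) T.e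
  simp only [mul_apply_eq_comp, sub_apply, smul_apply, one_apply_eq_self,
    T.B_e, smul_zero, sub_zero] at h1
  simp [ev, h1, T.ε_e]

/-- Since `B S = 1`, the resolvent satisfies `R S = S + z R`, and `ε` kills the range of `S`. Thus
`ev z` is an eigenfunctional of `S` with eigenvalue `z`. -/
theorem ev_S {z : ℂ} (hz : IsUnit (1 - z • T.B)) : T.ev z ∘L T.S = z • T.ev z := by
  set R := Ring.inverse (1 - z • T.B) with hR
  have h1 : R * (1 - z • T.B) = 1 := Ring.inverse_mul_cancel _ hz
  ext v
  have h2 : R (T.S v) = T.S v + z • R v := by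
    have := DFunLike.congr_fun h1 (T.S v)
    simp only [mul_apply_eq_comp, sub_apply, smul_apply, one_apply_eq_self,
      T.B_S, map_sub, map_smul] at this
    exact sub_eq_iff_eq_add.1 this
  simp [ev, ← hR, h2, T.ε_S]

theorem ev_S_pow {z : ℂ} (hz : IsUnit (1 - z • T.B)) (k : ℕ) (v : H) :
    T.ev z ((T.S ^ k) v) = z ^ k * T.ev z v := by
  induction k with
  | zero => simp
  | succ k ih =>
    have := DFunLike.congr_fun (T.ev_S hz) ((T.S ^ k) v)
    simp only [ContinuousLinearMap.comp_apply, smul_apply, smul_eq_mul] at this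
    rw [pow_succ', mul_apply_eq_comp, this, ih]
    ring

variable [CompleteSpace H]

theorem analyticAt_ev : AnalyticAt ℂ T.ev 0 := by
  have h1 : AnalyticAt ℂ (fun z : ℂ => (1 : H →L[ℂ] H) - z • T.B) 0 :=
    analyticAt_const.sub (analyticAt_id.smul analyticAt_const)
  have h2 : AnalyticAt ℂ (fun z : ℂ => Ring.inverse ((1 : H →L[ℂ] H) - z • T.B)) 0 :=
    AnalyticAt.comp_of_eq (analyticAt_inverse (𝕜 := ℂ) (1 : (H →L[ℂ] H)ˣ)) h1 (by simp)
  exact ((ContinuousLinearMap.compL ℂ H H ℂ T.ε).analyticAt _).comp h2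

theorem eventually_isUnit : ∀ᶠ z : ℂ in 𝓝 0, IsUnit (1 - z • T.B) := by
  have h : Tendsto (fun z : ℂ => (1 : H →L[ℂ] H) - z • T.B) (𝓝 0) (𝓝 1) := by
    have : Continuous fun z : ℂ => (1 : H →L[ℂ] H) - z • T.B := by fun_prop
    simpa using this.tendsto 0
  exact h.eventually (Units.isOpen.mem_nhds isUnit_one)

/-- All Taylor coefficients vanish: if `ev z u` is zero near `0`, then `u = S (B u)`, so `z * ev z
(B u) = 0`; dividing by `z` and using continuity at `0` passes from `u` to `B u`. -/
theorem eq_zero_of_eventually_ev_eq_zero {v : H} (hv : ∀ᶠ z in 𝓝 0, T.ev z v = 0) : v = 0 := by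
  have key : ∀ n : ℕ, ∀ᶠ z in 𝓝 0, T.ev z ((T.B ^ n) v) = 0 := by
    intro n
    induction n with
    | zero => simpa using hv
    | succ n ih =>
      set u := (T.B ^ n) v
      have hu : T.S (T.B u) = u := by
        have h0 : T.ε u = 0 := by simpa [T.ev_zero] using ih.self_of_nhds
        simpa [h0] using T.S_B u
      rw [pow_succ', mul_apply_eq_comp]
      have hc : ContinuousAt (fun z => T.ev z (T.B u)) 0 :=
        ((ContinuousLinearMap.apply ℂ ℂ (T.B u)).continuous.continuousAt).comp
          T.analyticAt_ev.continuousAt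
      refine (ContinuousAt.eventuallyEq_nhds_iff_eventuallyEq_nhdsNE hc
        (continuousAt_const (y := (0 : ℂ)))).1 ?_
      filter_upwards [ih.filter_mono nhdsWithin_le_nhds,
        T.eventually_isUnit.filter_mono nhdsWithin_le_nhds, self_mem_nhdsWithin] with z h1 h2 h3
      have := DFunLike.congr_fun (T.ev_S h2) (T.B u)
      simp only [ContinuousLinearMap.comp_apply, smul_apply, smul_eq_mul, hu, h1] at this
      exact (mul_eq_zero.1 this.symm).resolve_left h3
  refine T.separates v fun n => ?_
  simpa [T.ev_zero] using (key n).self_of_nhds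

end ShiftSystem

/-! ### Weierstrass division with parameters -/

open scoped BoundedContinuousFunction

theorem _root_.AnalyticAt.clm_apply_of_clm {E F G : Type*} [NormedAddCommGroup E]
    [NormedSpace ℂ E] [NormedAddCommGroup F] [NormedSpace ℂ F] [NormedAddCommGroup G]
    [NormedSpace ℂ G] {f : E → F →L[ℂ] G} {g : E → F} {x : E} (hf : AnalyticAt ℂ f x)
    (hg : AnalyticAt ℂ g x) : AnalyticAt ℂ (fun y => f y (g y)) x :=
  ((ContinuousLinearMap.id ℂ (F →L[ℂ] G)).analyticAt_bilinear (f x, g x)).comp₂ hf hg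

/-- The operators substituted for the coordinates `z, t₁, …, t_d`: the shift for `z`, scalars for
the `tᵢ`. -/
noncomputable def coordOperators {d : ℕ} {H : Type*} [NormedAddCommGroup H] [NormedSpace ℂ H]
    (S : H →L[ℂ] H) (t : Fin d → ℂ) : Fin (d + 1) → H →L[ℂ] H :=
  Fin.cons S fun i => t i • 1

theorem analyticAt_coordOperators {d : ℕ} {H : Type*} [NormedAddCommGroup H] [NormedSpace ℂ H]
    (S : H →L[ℂ] H) (t : Fin d → ℂ) : AnalyticAt ℂ (coordOperators (d := d) S) t := by
  refine AnalyticAt.pi fun i => ?_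
  refine Fin.cases ?_ (fun i => ?_) i
  · exact analyticAt_const
  · exact ((ContinuousLinearMap.proj (R := ℂ) (φ := fun _ : Fin d => ℂ) i).analyticAt t).smul
      analyticAt_const

theorem norm_coordOperators_zero_le {d : ℕ} {H : Type*} [NormedAddCommGroup H] [NormedSpace ℂ H]
    (S : H →L[ℂ] H) : ‖coordOperators (d := d) S 0‖ ≤ ‖S‖ := by
  refine (pi_norm_le_iff_of_nonneg (norm_nonneg S)).2 fun i => ?_
  refine Fin.cases ?_ (fun i => ?_) i <;> simp [coordOperators]

/-- The family `A t` is `F` evaluated at the shift and the scalars `t i`, so `ev` sees it as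
multiplication by `F`. Since evaluations near `0` separate vectors, the restriction of `F` to the
axis determines `A 0`. -/
theorem ShiftSystem.exists_operatorFamily {d : ℕ} {H : Type*} [NormedAddCommGroup H]
    [NormedSpace ℂ H] [CompleteSpace H] (T : ShiftSystem H) {ρ : ℝ} (hS : ‖T.S‖ < ρ)
    {F : (Fin (d + 1) → ℂ) → ℂ} {Φ : (Fin (d + 1) → H →L[ℂ] H) → H →L[ℂ] H}
    (hΦ : AnalyticOnNhd ℂ Φ (Metric.ball 0 ρ))
    (hΦF : ∀ x ∈ Metric.ball 0 ρ, ∀ y ∈ Metric.ball 0 ρ, ∀ φ : H →L[ℂ] ℂ,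
        (∀ i, φ ∘L x i = y i • φ) → φ ∘L Φ x = F y • φ) :
    ∃ A : (Fin d → ℂ) → H →L[ℂ] H, AnalyticAt ℂ A 0 ∧
      (∀ᶠ x : Fin (d + 1) → ℂ in 𝓝 0, ∀ v, T.ev (x 0) (A (fun i => x i.succ) v) =
        F x * T.ev (x 0) v) ∧
      ∀ k, (∀ᶠ z in 𝓝 0, F (Fin.cons z 0) = z ^ k) → A 0 = T.S ^ k := by
  have hmem : coordOperators (d := d) T.S 0 ∈ Metric.ball 0 ρ := by
    simpa using (norm_coordOperators_zero_le T.S).trans_lt hS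
  have hρ : 0 < ρ := (norm_nonneg _).trans_lt hS
  have hev : ∀ᶠ x : Fin (d + 1) → ℂ in 𝓝 0, ∀ v,
      T.ev (x 0) (Φ (coordOperators T.S (fun i => x i.succ)) v) = F x * T.ev (x 0) v := by
    have h0 : Tendsto (fun x : Fin (d + 1) → ℂ => x 0) (𝓝 0) (𝓝 0) :=
      (continuous_apply 0).tendsto' _ _ rfl
    have h1 : Tendsto (fun x : Fin (d + 1) → ℂ => coordOperators T.S (fun i => x i.succ)) (𝓝 0)
        (𝓝 (coordOperators T.S 0)) :=
      (analyticAt_coordOperators T.S 0).continuousAt.tendsto.comp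
        ((by fun_prop : Continuous fun (x : Fin (d + 1) → ℂ) (i : Fin d) => x i.succ).tendsto'
          _ _ rfl)
    filter_upwards [h0.eventually T.eventually_isUnit,
      h1.eventually (Metric.isOpen_ball.mem_nhds hmem), Metric.ball_mem_nhds 0 hρ]
      with x hx1 hx2 hx3 v
    refine DFunLike.congr_fun (hΦF _ hx2 x hx3 (T.ev (x 0)) fun i => ?_) v
    refine Fin.cases ?_ (fun i => ?_) i
    · exact T.ev_S hx1
    · ext v
      simp [coordOperators]
  refine ⟨fun t => Φ (coordOperators T.S t), (hΦ _ hmem).comp (analyticAt_coordOperators _ _),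
    hev, fun k hk => ?_⟩
  ext v
  rw [← sub_eq_zero]
  refine T.eq_zero_of_eventually_ev_eq_zero ?_
  have h2 : Tendsto (fun z : ℂ => (Fin.cons z 0 : Fin (d + 1) → ℂ)) (𝓝 0) (𝓝 0) := by
    have : Continuous fun z : ℂ => (Fin.cons z 0 : Fin (d + 1) → ℂ) := by fun_prop
    refine this.tendsto' _ _ ?_
    ext i
    refine Fin.cases ?_ (fun i => ?_) i <;> simp
  filter_upwards [h2.eventually hev, hk, T.eventually_isUnit] with z h3 h4 h5
  have h6 := h3 v
  simp only [Fin.cons_zero, Fin.cons_succ, h4] at h6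
  rw [map_sub, T.ev_S_pow h5, sub_eq_zero, ← h6]

theorem weierstrass_division {d k : ℕ} {W F : (Fin (d + 1) → ℂ) → ℂ} (hW : AnalyticAt ℂ W 0)
    (hW0 : ∀ᶠ z in 𝓝 0, W (Fin.cons z 0) = z ^ k) (hF : AnalyticAt ℂ F 0) :
    ∃ (q : (Fin (d + 1) → ℂ) → ℂ) (c : ℕ → (Fin d → ℂ) → ℂ), AnalyticAt ℂ q 0 ∧
      (∀ j, AnalyticAt ℂ (c j) 0) ∧
      (∀ᶠ x in 𝓝 0, F x = q x * W x +
        ∑ j ∈ Finset.range k, c j (fun i => x i.succ) * x 0 ^ j) ∧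
      ((∀ᶠ z in 𝓝 0, F (Fin.cons z 0) = z ^ k) → ∀ j < k, c j 0 = 0) := by
  have : Nontrivial (ℕ →ᵇ ℂ) := ⟨0, BoundedContinuousFunction.const ℕ 1, fun h => by
    simpa using DFunLike.congr_fun h 0⟩
  obtain ⟨ρ, hρ, Φ, hΦ, hΦW⟩ := exists_operatorCalculus (ℕ →ᵇ ℂ) hW
  obtain ⟨ρ', hρ', Ψ, hΨ, hΨF⟩ := exists_operatorCalculus (ℕ →ᵇ ℂ) hF
  obtain ⟨T, hT⟩ := ShiftSystem.exists_norm_S_le (half_pos (lt_min hρ hρ'))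
  have hT' : ‖T.S‖ < min ρ ρ' := hT.trans_lt (half_lt_self (lt_min hρ hρ'))
  obtain ⟨A, hA, hAW, hA0⟩ := T.exists_operatorFamily (lt_min_iff.1 hT').1 hΦ hΦW
  obtain ⟨C, hC, hCF, hC0⟩ := T.exists_operatorFamily (lt_min_iff.1 hT').2 hΨ hΨF
  let N : (ℕ →ᵇ ℂ) →L[ℂ] (ℕ →ᵇ ℂ) := ∑ j ∈ Finset.range k,
    (T.ε ∘L T.B ^ j).smulRight ((T.S ^ j) T.e)
  -- Applying `T.ev z` to `M t v = C t e` yields `F = W * ev z (B ^ k v) + ∑ ε (B ^ j v) * z ^ j`,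
  -- so quotient and remainder are read off `v`. At `t = 0` one has `A 0 = S ^ k`, and `M 0 = 1` is
  -- Taylor's formula.
  let M : (Fin d → ℂ) → (ℕ →ᵇ ℂ) →L[ℂ] (ℕ →ᵇ ℂ) := fun t => A t * T.B ^ k + N
  have hN : ∀ v, N v = ∑ j ∈ Finset.range k, T.ε ((T.B ^ j) v) • (T.S ^ j) T.e := by
    intro v; simp [N]
  have hM0 : M 0 = 1 := by
    ext1 v
    have := T.expansion k v
    rw [← hN] at this
    simpa [M, hA0 k hW0] using this
  have hM : AnalyticAt ℂ M 0 := (hA.mul analyticAt_const).add analyticAt_const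
  have hMi : AnalyticAt ℂ (fun t => Ring.inverse (M t)) 0 :=
    AnalyticAt.comp_of_eq (analyticAt_inverse (𝕜 := ℂ) (1 : ((ℕ →ᵇ ℂ) →L[ℂ] (ℕ →ᵇ ℂ))ˣ)) hM
      (by simp [hM0])
  let v : (Fin d → ℂ) → (ℕ →ᵇ ℂ) := fun t => Ring.inverse (M t) (C t T.e)
  have hv : AnalyticAt ℂ v 0 := hMi.clm_apply_of_clm (hC.clm_apply_of_clm analyticAt_const)
  have hMv : ∀ᶠ t in 𝓝 0, M t (v t) = C t T.e := by
    have : ∀ᶠ t in 𝓝 0, IsUnit (M t) := hM.continuousAt.eventually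
      (Units.isOpen.mem_nhds (by rw [hM0]; exact isUnit_one))
    filter_upwards [this] with t ht
    exact DFunLike.congr_fun (Ring.mul_inverse_cancel _ ht) (C t T.e)
  let π : (Fin (d + 1) → ℂ) →L[ℂ] (Fin d → ℂ) :=
    ContinuousLinearMap.pi fun i => ContinuousLinearMap.proj i.succ
  have hπ : ∀ {E : Type} [NormedAddCommGroup E] [NormedSpace ℂ E] {g : (Fin d → ℂ) → E},
      AnalyticAt ℂ g 0 → AnalyticAt ℂ (fun x => g (π x)) 0 := fun hg =>
    AnalyticAt.comp_of_eq hg (π.analyticAt 0) (map_zero π)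
  have h0 : AnalyticAt ℂ (fun x : Fin (d + 1) → ℂ => T.ev (x 0)) 0 :=
    AnalyticAt.comp_of_eq (g := T.ev) T.analyticAt_ev
      ((ContinuousLinearMap.proj (R := ℂ) (φ := fun _ : Fin (d + 1) => ℂ) 0).analyticAt 0) rfl
  refine ⟨fun x => T.ev (x 0) ((T.B ^ k) (v (π x))), fun j t => T.ε ((T.B ^ j) (v t)), ?_, ?_,
    ?_, ?_⟩
  · exact h0.clm_apply_of_clm (analyticAt_const.clm_apply_of_clm (hπ hv))
  · intro j
    exact analyticAt_const.clm_apply_of_clm (analyticAt_const.clm_apply_of_clm hv)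
  · filter_upwards [hAW, hCF, (π.continuous.tendsto' 0 0 (map_zero π)).eventually hMv,
      ((continuous_apply (0 : Fin (d + 1))).tendsto' 0 (0 : ℂ) rfl).eventually
        T.eventually_isUnit] with x h1 h2 h3 h4
    have h5 := h2 T.e
    rw [T.ev_e h4, mul_one] at h5
    rw [← h5]
    change T.ev (x 0) (C (π x) T.e) = _
    rw [← h3]
    change T.ev (x 0) (A (π x) ((T.B ^ k) (v (π x))) + N (v (π x))) = _
    rw [map_add, hN, map_sum, mul_comm, ← h1]
    congr 1
    refine Finset.sum_congr rfl fun j _ => ?_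
    rw [map_smul, T.ev_S_pow h4, T.ev_e h4, mul_one]
    rfl
  · intro h j hj
    have : v 0 = (T.S ^ k) T.e := by simp [v, hM0, hC0 k h]
    change T.ε ((T.B ^ j) (v 0)) = 0
    rw [this, T.ε_B_pow_S_pow hj]

/-! ### Elimination of a variable and size of roots -/

open Polynomial

theorem isIntegral_of_monic_mem {R : Type*} [CommRing R] (I : Ideal R[X]) {ω : R[X]}
    (hω : ω.Monic) (hωI : ω ∈ I) : Algebra.IsIntegral R (R[X] ⧸ I) := by
  refine ⟨fun a => ?_⟩
  obtain ⟨p, rfl⟩ := Ideal.Quotient.mk_surjective a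
  have hX : IsIntegral R (Ideal.Quotient.mk I X) := by
    refine ⟨ω, hω, ?_⟩
    have : eval₂ (algebraMap R (R[X] ⧸ I)) (Ideal.Quotient.mk I X) ω = Ideal.Quotient.mk I ω := by
      conv_rhs => rw [← eval₂_C_X (p := ω), hom_eval₂]
      rfl
    rw [this, Ideal.Quotient.eq_zero_iff_mem]
    exact hωI
  induction p using Polynomial.induction_on' with
  | add p q hp hq => rw [map_add]; exact hp.add hq
  | monomial n r =>
    rw [← C_mul_X_pow_eq_monomial, map_mul, map_pow]
    exact (isIntegral_algebraMap (x := r) (A := R[X] ⧸ I)).mul (hX.pow n)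

theorem exists_common_root_of_ne_top {K : Type*} [Field K] [IsAlgClosed K] {J : Ideal K[X]}
    (hJ : J ≠ ⊤) : ∃ z, ∀ p ∈ J, p.eval z = 0 := by
  obtain ⟨h, rfl⟩ := (IsPrincipalIdealRing.principal J).principal
  by_cases h0 : h = 0
  · exact ⟨0, fun p hp => by simp_all⟩
  have hu : ¬ IsUnit h := fun hu => hJ (Ideal.span_singleton_eq_top.2 hu)
  obtain ⟨z, hz⟩ := IsAlgClosed.exists_root h fun h1 =>
    hu (isUnit_iff_degree_eq_zero.2 h1)
  refine ⟨z, fun p hp => ?_⟩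
  obtain ⟨q, rfl⟩ := Ideal.mem_span_singleton.1 hp
  simp [hz.eq_zero]

/-- Elimination of one variable: the vanishing of finitely many elements of the elimination ideal
at a character guarantees a common root over it. -/
theorem exists_finset_eliminating {K A B : Type*} [Field K] [IsAlgClosed K] [CommRing A]
    [CommRing B] [Algebra K A] (ι : A →+* B) (P : Ideal B) (z : B) (T : Finset A[X]) {ω : A[X]}
    (hω : ω.Monic) (hωT : ω ∈ T) (hT : ∀ G ∈ T, eval₂ ι z G ∈ P) :
    ∃ I : Finset A, (∀ c ∈ I, ι c ∈ P) ∧ ∀ χ : A →ₐ[K] K, (∀ c ∈ I, χ c = 0) →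
      ∃ z₀ : K, ∀ G ∈ T, eval₂ (χ : A →+* K) z₀ G = 0 := by
  classical
  -- Only the finitely many coefficients matter. The subalgebra they generate is Noetherian,
  -- whatever `A` is, so the contraction of `P₁` to it is finitely generated; its generators form
  -- `I`.
  let R := Algebra.adjoin K (T.biUnion (fun G => G.coeffs) : Set A)
  have hRft : Algebra.FiniteType K R :=
    (Subalgebra.fg_iff_finiteType _).1 (Subalgebra.fg_adjoin_finset _)
  have hRN : IsNoetherianRing R := Algebra.FiniteType.isNoetherianRing K R
  have hlift : ∀ G ∈ T, ∃ G₀ : R[X], G₀.map (algebraMap R A) = G := by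
    intro G hG
    refine (mem_lifts G).1 ((lifts_iff_coeff_lifts G).2 fun n => ?_)
    by_cases hn : G.coeff n = 0
    · exact ⟨0, by simp [hn]⟩
    · exact ⟨⟨G.coeff n, Algebra.subset_adjoin (Finset.mem_coe.2 (Finset.mem_biUnion.2
        ⟨G, hG, coeff_mem_coeffs hn⟩))⟩, rfl⟩
  let P₁ : Ideal R[X] := P.comap (eval₂RingHom (ι.comp (algebraMap R A)) z)
  have hP₁ : ∀ G₀ : R[X], G₀.map (algebraMap R A) ∈ T → G₀ ∈ P₁ := by
    intro G₀ h
    have := hT _ h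
    rw [eval₂_map] at this
    exact this
  obtain ⟨ω₀, hω₀⟩ := hlift ω hωT
  have hω₀m : ω₀.Monic := by
    rw [← hω₀] at hω
    exact (Function.Injective.monic_map_iff Subtype.val_injective).2 hω
  have hint := isIntegral_of_monic_mem P₁ hω₀m (hP₁ ω₀ (by rwa [hω₀]))
  obtain ⟨I, hI⟩ := (isNoetherianRing_iff_ideal_fg R).1 hRN (P₁.comap C)
  refine ⟨I.image (algebraMap R A), ?_, fun χ hχ => ?_⟩
  · intro c hc
    obtain ⟨c, hcI, rfl⟩ := Finset.mem_image.1 hc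
    have : c ∈ P₁.comap C := hI ▸ Ideal.subset_span hcI
    have : eval₂ (ι.comp (algebraMap R A)) z (C c) ∈ P := this
    simpa using this
  let χ₀ : R →ₐ[K] K := χ.comp R.val
  have hχ₀ : Function.Surjective (χ₀ : R →+* K) := fun a => ⟨algebraMap K R a, χ₀.commutes a⟩
  have hker : P₁.comap C ≤ RingHom.ker (χ₀ : R →+* K) := by
    rw [← hI, Ideal.span_le]
    exact fun c hc => hχ _ (Finset.mem_image_of_mem _ hc)
  have hprime : (RingHom.ker (χ₀ : R →+* K)).IsPrime := RingHom.ker_isPrime _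
  -- Lying over, in place of resultants: the monic `ω` makes `R[X] ⧸ P₁` integral over `R`, so the
  -- kernel of the character lifts to a prime `Q`. Its image in `K[X]` is proper and hence has a
  -- common root.
  obtain ⟨Q, -, hQp, hQ⟩ := Ideal.exists_ideal_over_prime_of_isIntegral
    (RingHom.ker (χ₀ : R →+* K)) (⊥ : Ideal (R[X] ⧸ P₁)) (fun a ha => hker (by
      have : Ideal.Quotient.mk P₁ (C a) = 0 := ha
      exact (Ideal.Quotient.eq_zero_iff_mem (I := P₁)).1 this))
  let Q' : Ideal R[X] := Q.comap (Ideal.Quotient.mk P₁)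
  have hPQ : P₁ ≤ Q' := fun a ha => by
    change Ideal.Quotient.mk P₁ a ∈ Q
    rw [Ideal.Quotient.eq_zero_iff_mem.2 ha]
    exact Q.zero_mem
  have hkerQ : RingHom.ker (mapRingHom (χ₀ : R →+* K)) ≤ Q' := by
    rw [ker_mapRingHom, Ideal.map_le_iff_le_comap]
    intro a ha
    rw [← hQ] at ha
    exact ha
  have hJ : Q'.map (mapRingHom (χ₀ : R →+* K)) ≠ ⊤ := by
    rw [Ne, Ideal.map_eq_top_iff_of_ker_le _ hkerQ]
    · exact (Ideal.IsPrime.comap (Ideal.Quotient.mk P₁) (hK := hQp)).ne_top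
    · exact RingHom.isIntegral_of_surjective _ (map_surjective _ hχ₀)
  obtain ⟨z₀, hz₀⟩ := exists_common_root_of_ne_top hJ
  refine ⟨z₀, fun G hG => ?_⟩
  obtain ⟨G₀, rfl⟩ := hlift G hG
  have := hz₀ _ (Ideal.mem_map_of_mem _ (hPQ (hP₁ G₀ hG)))
  rw [coe_mapRingHom, eval_map] at this
  rw [eval₂_map]
  exact this

/-- If `‖z‖ ≥ ε`, then `‖z‖ ^ j * ε ^ k ≤ ‖z‖ ^ k * ε ^ j` for `j < k`, so a root forces `ε ^ k ≤ ∑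
‖c j t‖ * ε ^ j`, which fails near `x₀`. -/
theorem eventually_norm_root_lt {X : Type*} [TopologicalSpace X] {x₀ : X} {k : ℕ}
    {c : ℕ → X → ℂ} (hc : ∀ j, ContinuousAt (c j) x₀) (hc0 : ∀ j < k, c j x₀ = 0) {ε : ℝ}
    (hε : 0 < ε) :
    ∀ᶠ t in 𝓝 x₀, ∀ z : ℂ, z ^ k = ∑ j ∈ Finset.range k, c j t * z ^ j → ‖z‖ < ε := by
  have h1 : Tendsto (fun t => ∑ j ∈ Finset.range k, ‖c j t‖ * ε ^ j) (𝓝 x₀)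
      (𝓝 (∑ j ∈ Finset.range k, ‖c j x₀‖ * ε ^ j)) :=
    tendsto_finsetSum _ fun j _ => (hc j).norm.mul_const _
  have h2 : ∑ j ∈ Finset.range k, ‖c j x₀‖ * ε ^ j < ε ^ k := by
    rw [Finset.sum_eq_zero fun j hj => by rw [hc0 j (Finset.mem_range.1 hj)]; simp]
    positivity
  filter_upwards [h1.eventually (gt_mem_nhds h2)] with t ht z hz
  by_contra! hzε
  have hz0 : 0 < ‖z‖ := hε.trans_le hzε
  have h3 : ‖z‖ ^ k * ε ^ k ≤ ‖z‖ ^ k * ∑ j ∈ Finset.range k, ‖c j t‖ * ε ^ j := by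
    calc ‖z‖ ^ k * ε ^ k = ‖z ^ k‖ * ε ^ k := by rw [norm_pow]
      _ ≤ (∑ j ∈ Finset.range k, ‖c j t‖ * ‖z‖ ^ j) * ε ^ k := by
          gcongr
          rw [hz]
          refine (norm_sum_le _ _).trans_eq ?_
          simp
      _ = ∑ j ∈ Finset.range k, ‖c j t‖ * (‖z‖ ^ j * ε ^ k) := by
          rw [Finset.sum_mul]; exact Finset.sum_congr rfl fun _ _ => by ring
      _ ≤ ∑ j ∈ Finset.range k, ‖c j t‖ * (‖z‖ ^ k * ε ^ j) := by
          refine Finset.sum_le_sum fun j hj => mul_le_mul_of_nonneg_left ?_ (norm_nonneg _)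
          obtain ⟨l, rfl⟩ := Nat.exists_eq_add_of_le (Finset.mem_range.1 hj).le
          rw [pow_add, pow_add]
          have : ε ^ l ≤ ‖z‖ ^ l := by gcongr
          calc ‖z‖ ^ j * (ε ^ j * ε ^ l) = (‖z‖ ^ j * ε ^ j) * ε ^ l := by ring
            _ ≤ (‖z‖ ^ j * ε ^ j) * ‖z‖ ^ l := by gcongr
            _ = _ := by ring
      _ = _ := by
          rw [Finset.mul_sum]; exact Finset.sum_congr rfl fun _ _ => by ring
  exact absurd (le_of_mul_le_mul_left h3 (by positivity)) (not_le.2 ht)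

/-! ### Functions analytic at `0` and their germs -/

/-- The algebra of all functions on `ℂⁿ` that are analytic at `0`. -/
def AnFun (n : ℕ) : Subalgebra ℂ ((Fin n → ℂ) → ℂ) where
  carrier := {F | AnalyticAt ℂ F 0}
  mul_mem' hF hG := AnalyticAt.mul hF hG
  add_mem' hF hG := AnalyticAt.add hF hG
  algebraMap_mem' _ := analyticAt_const

/-- Passage to the germ at `0`. -/
noncomputable def germHom (n : ℕ) : AnFun n →+* 𝒪 n where
  toFun F := toGerm F.1 F.2
  map_one' := rfl
  map_mul' _ _ := rfl
  map_zero' := rfl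
  map_add' _ _ := rfl

theorem germHom_surjective (n : ℕ) : Function.Surjective (germHom n) := by
  rintro ⟨_, F, hF, rfl⟩
  exact ⟨⟨F, hF⟩, rfl⟩

theorem germHom_eq_iff {n : ℕ} {F G : AnFun n} :
    germHom n F = germHom n G ↔ F.1 =ᶠ[𝓝 0] G.1 := by
  rw [Subtype.ext_iff]
  exact Germ.coe_eq

theorem isUnit_germHom {n : ℕ} {F : AnFun n} (hF : F.1 0 ≠ 0) : IsUnit (germHom n F) := by
  refine IsUnit.of_mul_eq_one (germHom n ⟨_, F.2.inv hF⟩) ?_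
  rw [← map_mul, ← map_one (germHom n), germHom_eq_iff]
  filter_upwards [F.2.continuousAt.eventually_ne hF] with x hx
  exact mul_inv_cancel₀ hx

/-- Evaluation at a point. -/
def evalAt {n : ℕ} (t : Fin n → ℂ) : AnFun n →ₐ[ℂ] ℂ :=
  (Pi.evalAlgHom ℂ (fun _ : Fin n → ℂ => ℂ) t).comp (AnFun n).val

/-- The pull-back of germs as a ring homomorphism. -/
noncomputable def pullbackHom {i n : ℕ} (p : (Fin i → ℂ) →ₗ[ℂ] (Fin n → ℂ)) : 𝒪 n →+* 𝒪 i where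
  toFun := pullback p
  map_one' := rfl
  map_mul' := by rintro ⟨_, F, hF, rfl⟩ ⟨_, G, hG, rfl⟩; rfl
  map_zero' := rfl
  map_add' := by rintro ⟨_, F, hF, rfl⟩ ⟨_, G, hG, rfl⟩; rfl

/-- The pull-back of functions as a ring homomorphism. -/
def compHom {i n : ℕ} (p : (Fin i → ℂ) →ₗ[ℂ] (Fin n → ℂ)) : AnFun n →+* AnFun i where
  toFun F := ⟨F.1 ∘ p, AnalyticAt.comp_of_eq F.2 (analyticAt_linearMap p) (map_zero p)⟩
  map_one' := rfl
  map_mul' _ _ := rfl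
  map_zero' := rfl
  map_add' _ _ := rfl

theorem pullbackHom_germHom {i n : ℕ} (p : (Fin i → ℂ) →ₗ[ℂ] (Fin n → ℂ)) (F : AnFun n) :
    pullbackHom p (germHom n F) = germHom i (compHom p F) := rfl

/-- The projection forgetting the first coordinate. -/
def dropFirst (d : ℕ) : (Fin (d + 1) → ℂ) →ₗ[ℂ] (Fin d → ℂ) := LinearMap.funLeft ℂ ℂ Fin.succ

/-- The first coordinate function. -/
def firstCoord (d : ℕ) : AnFun (d + 1) :=
  ⟨fun x => x 0, (ContinuousLinearMap.proj (R := ℂ) (φ := fun _ : Fin (d + 1) => ℂ) 0).analyticAt 0⟩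

/-- Weierstrass division, for functions in the ring `AnFun`. -/
theorem exists_division {d k : ℕ} {W : AnFun (d + 1)}
    (hW0 : ∀ᶠ z in 𝓝 0, W.1 (Fin.cons z 0) = z ^ k) (F : AnFun (d + 1)) :
    ∃ (q : AnFun (d + 1)) (c : ℕ → AnFun d),
      germHom _ F = germHom _ (q * W +
        ∑ j ∈ Finset.range k, compHom (dropFirst d) (c j) * firstCoord d ^ j) ∧
      ((∀ᶠ z in 𝓝 0, F.1 (Fin.cons z 0) = z ^ k) → ∀ j < k, (c j).1 0 = 0) := by
  obtain ⟨q, c, hq, hc, h, h0⟩ := weierstrass_division W.2 hW0 F.2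
  refine ⟨⟨q, hq⟩, fun j => ⟨c j, hc j⟩, germHom_eq_iff.2 ?_, h0⟩
  filter_upwards [h] with x hx
  rw [hx]
  simp only [AddMemClass.coe_add, MulMemClass.coe_mul, AddSubmonoidClass.coe_finsetSum,
    SubmonoidClass.coe_pow, Pi.add_apply, Pi.mul_apply, Finset.sum_apply, Pi.pow_apply]
  rfl

/-! ### The Rückert Nullstellensatz -/

/-- Points of the zero set of a prime ideal, near `0`, off the zero set of a function that does
not belong to it. -/
def HasPoints (d : ℕ) : Prop :=
  ∀ (P : Ideal (𝒪 d)) [P.IsPrime] (f : AnFun d), germHom d f ∉ P → ∀ s : Finset (AnFun d),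
    (∀ g ∈ s, germHom d g ∈ P) → ∃ᶠ x in 𝓝 0, (∀ g ∈ s, g.1 x = 0) ∧ f.1 x ≠ 0

/-- Division by `W` makes the quotient by `P` finite over `𝒪 d`, so `f` is integral modulo `P`. As
`P` is prime and `f ∉ P`, some coefficient of the integral equation lies in `P + (f)` but not in
`P`. Where `b` vanishes and `g` does not, `f` does not vanish. -/
theorem exists_pullback_mem_sup {d k : ℕ} (P : Ideal (𝒪 (d + 1))) [P.IsPrime]
    {W : AnFun (d + 1)} (hWP : germHom _ W ∈ P)
    (hW0 : ∀ᶠ z in 𝓝 0, W.1 (Fin.cons z 0) = z ^ k) {f : 𝒪 (d + 1)} (hf : f ∉ P) :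
    ∃ g : 𝒪 d, pullbackHom (dropFirst d) g ∉ P ∧
      ∃ b ∈ P, ∃ a, pullbackHom (dropFirst d) g = b + a * f := by
  classical
  let ι := pullbackHom (dropFirst d)
  let φ : 𝒪 d →+* 𝒪 (d + 1) ⧸ P := (Ideal.Quotient.mk P).comp ι
  let _ := φ.toAlgebra
  have hfin : Module.Finite (𝒪 d) (𝒪 (d + 1) ⧸ P) := by
    refine ⟨⟨(Finset.range k).image fun j =>
      Ideal.Quotient.mk P (germHom _ (firstCoord d) ^ j), ?_⟩⟩
    rw [eq_top_iff]
    rintro a -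
    obtain ⟨a, rfl⟩ := Ideal.Quotient.mk_surjective a
    obtain ⟨F, rfl⟩ := germHom_surjective _ a
    obtain ⟨q, c, h, -⟩ := exists_division hW0 F
    have h1 : Ideal.Quotient.mk P (germHom _ F) = ∑ j ∈ Finset.range k,
        germHom d (c j) • Ideal.Quotient.mk P (germHom _ (firstCoord d) ^ j) := by
      rw [h, map_add, map_mul, map_add, Ideal.Quotient.eq_zero_iff_mem.2 (P.mul_mem_left _ hWP),
        zero_add, map_sum, map_sum]
      refine Finset.sum_congr rfl fun j _ => ?_
      rw [map_mul, map_mul, map_pow]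
      rfl
    rw [h1]
    exact Submodule.sum_mem _ fun j hj => Submodule.smul_mem _ _
      (Submodule.subset_span (Finset.mem_image_of_mem _ hj))
  obtain ⟨p, hp, hpf⟩ := Algebra.IsIntegral.isIntegral (R := 𝒪 d) (Ideal.Quotient.mk P f)
  have hpf' : p.eval₂ ι f ∈ P := by
    rw [← Ideal.Quotient.eq_zero_iff_mem, Polynomial.hom_eval₂]
    exact hpf
  obtain ⟨i, hi1, hi2⟩ := Ideal.exists_coeff_mem_comap_sdiff_comap_of_root_mem_sdiff (f := ι)
    (I := P) (J := P ⊔ Ideal.span {f}) le_sup_left (r := f)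
    ⟨Ideal.mem_sup_right (Ideal.mem_span_singleton_self f), hf⟩ (p := p)
    (hp.map _).ne_zero hpf'
  refine ⟨p.coeff i, hi2, ?_⟩
  obtain ⟨b, hb, y, hy, h⟩ := Submodule.mem_sup.1 hi1
  obtain ⟨a, rfl⟩ := Ideal.mem_span_singleton'.1 hy
  exact ⟨b, hb, a, h.symm⟩

theorem frequently_of_monic {d k : ℕ} (ih : HasPoints d) (P : Ideal (𝒪 (d + 1))) [P.IsPrime]
    {W : AnFun (d + 1)} (hWP : germHom _ W ∈ P)
    (hW0 : ∀ᶠ z in 𝓝 0, W.1 (Fin.cons z 0) = z ^ k) (f : AnFun (d + 1)) (hf : germHom _ f ∉ P)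
    (s : Finset (AnFun (d + 1))) (hs : ∀ g ∈ s, germHom _ g ∈ P) :
    ∃ᶠ x in 𝓝 0, (∀ g ∈ s, g.1 x = 0) ∧ f.1 x ≠ 0 := by
  classical
  obtain ⟨g', hg', b', hb', a', hab⟩ := exists_pullback_mem_sup P hWP hW0 hf
  obtain ⟨g, rfl⟩ := germHom_surjective _ g'
  obtain ⟨b, rfl⟩ := germHom_surjective _ b'
  obtain ⟨a, rfl⟩ := germHom_surjective _ a'
  let ι := compHom (dropFirst d)
  let z := firstCoord d
  -- Weierstrass preparation: `z ^ k` minus its remainder modulo `W` is a monic polynomial in `z`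
  -- whose germ is a multiple of that of `W`, with lower coefficients vanishing at `0`.
  obtain ⟨q, r, hr, hr0⟩ := exists_division hW0 (z ^ k)
  replace hr0 := hr0 (Eventually.of_forall fun w => by simp [z, firstCoord])
  let rem : (ℕ → AnFun d) → Polynomial (AnFun d) := fun c =>
    ∑ j ∈ Finset.range k, Polynomial.C (c j) * Polynomial.X ^ j
  have hrem : ∀ {B : Type} [CommRing B] (φ : AnFun d →+* B) (w : B) (c : ℕ → AnFun d),
      (rem c).eval₂ φ w = ∑ j ∈ Finset.range k, φ (c j) * w ^ j := by
    intro B _ φ w c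
    simp [rem, Polynomial.eval₂_finsetSum]
  have hdeg : ∀ c, (rem c).degree < k := fun c =>
    (Polynomial.degree_sum_le _ _).trans_lt <| (Finset.sup_lt_iff (WithBot.bot_lt_coe k)).2
      fun j hj => (Polynomial.degree_C_mul_X_pow_le _ _).trans_lt
        (WithBot.coe_lt_coe.2 (Finset.mem_range.1 hj))
  let ω : Polynomial (AnFun d) := Polynomial.X ^ k - rem r
  have hω : ω.Monic := Polynomial.monic_X_pow_sub (hdeg r)
  let Ω : AnFun (d + 1) := ω.eval₂ ι z
  have hΩ : Ω = z ^ k - ∑ j ∈ Finset.range k, ι (r j) * z ^ j := by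
    simp only [Ω, ω, Polynomial.eval₂_sub, Polynomial.eval₂_X_pow, hrem]
  have hΩP : germHom _ Ω ∈ P := by
    rw [hΩ, map_sub, hr, ← map_sub, add_sub_cancel_right, map_mul]
    exact P.mul_mem_left _ hWP
  have hΩ0 : ∀ᶠ w in 𝓝 0, Ω.1 (Fin.cons w 0) = w ^ k := by
    refine Eventually.of_forall fun w => ?_
    have : ∀ j ∈ Finset.range k, (ι (r j) * z ^ j).1 (Fin.cons w 0) = 0 := by
      intro j hj
      have : (ι (r j)).1 (Fin.cons w 0) = 0 := hr0 j (Finset.mem_range.1 hj)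
      simp [this]
    rw [hΩ]
    simp only [AddSubgroupClass.coe_sub, AddSubmonoidClass.coe_finsetSum, Pi.sub_apply,
      Finset.sum_apply, Finset.sum_eq_zero this, sub_zero]
    simp [z, firstCoord]
  -- Dividing by `Ω` instead of `W` makes divisor and remainders polynomials in `z`, so that a
  -- common root `w` over `t` is a common zero `(w, t)`.
  choose Q C hQC _ using fun F => exists_division (W := Ω) hΩ0 F
  let s' := insert b s
  have hs' : ∀ g ∈ s', germHom _ g ∈ P := by
    intro g hg
    rcases Finset.mem_insert.1 hg with rfl | hg
    exacts [hb', hs g hg]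
  obtain ⟨I, hIP, hI⟩ := exists_finset_eliminating (K := ℂ) ((germHom (d + 1)).comp ι) P
    (germHom _ z) (insert ω (s'.image fun g => rem (C g))) hω (Finset.mem_insert_self _ _) (by
      intro G hG
      rcases Finset.mem_insert.1 hG with rfl | hG
      · rwa [← Polynomial.hom_eval₂]
      · obtain ⟨g, hg, rfl⟩ := Finset.mem_image.1 hG
        rw [← Polynomial.hom_eval₂, hrem]
        have h1 := hs' g hg
        rw [hQC g, map_add, map_mul] at h1
        exact (P.add_mem_iff_right (P.mul_mem_left _ hΩP)).1 h1)
  -- The induction hypothesis is applied to the contraction of `P` and to `g`, which certifies `f ≠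
  -- 0` upstairs; `b` was added to `s` for that purpose.
  have hfreq := ih (P.comap (pullbackHom (dropFirst d))) g hg' I hIP
  rw [frequently_iff]
  intro U hU
  have hev : ∀ᶠ x in 𝓝 (0 : Fin (d + 1) → ℂ), x ∈ U ∧
      (∀ g ∈ s', g.1 x = (Q g * Ω + ∑ j ∈ Finset.range k, ι (C g j) * z ^ j).1 x) ∧
      (ι g).1 x = (b + a * f).1 x := by
    refine (eventually_mem_set.2 hU).and (Eventually.and ?_ ?_)
    · rw [Filter.eventually_all_finset]
      exact fun g _ => germHom_eq_iff.1 (hQC g)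
    · rw [← map_mul, ← map_add] at hab
      exact germHom_eq_iff.1 hab
  obtain ⟨ε, hε, hball⟩ := Metric.eventually_nhds_iff.1 hev
  have hsmall := eventually_norm_root_lt (fun j => (r j).2.continuousAt) hr0 hε
  obtain ⟨t, ⟨htI, htg⟩, htε, htr⟩ :=
    (hfreq.and_eventually ((eventually_mem_set.2 (Metric.ball_mem_nhds 0 hε)).and hsmall)).exists
  obtain ⟨w, hw⟩ := hI (evalAt t) htI
  have hwω : w ^ k = ∑ j ∈ Finset.range k, (r j).1 t * w ^ j := by
    have := hw ω (Finset.mem_insert_self _ _)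
    simp only [ω, Polynomial.eval₂_sub, Polynomial.eval₂_X_pow, hrem] at this
    exact sub_eq_zero.1 this
  let x : Fin (d + 1) → ℂ := Fin.cons w t
  have hx : dist x 0 < ε := by
    rw [dist_zero_right, pi_norm_lt_iff hε]
    refine fun i => Fin.cases (htr w hwω) (fun i => ?_) i
    exact (norm_le_pi_norm t i).trans_lt (by simpa using htε)
  have hΩx : Ω.1 x = 0 := by
    have : Ω.1 x = w ^ k - ∑ j ∈ Finset.range k, (r j).1 t * w ^ j := by
      rw [hΩ]
      simp only [AddSubgroupClass.coe_sub, AddSubmonoidClass.coe_finsetSum, Pi.sub_apply,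
        Finset.sum_apply]
      rfl
    rw [this, hwω, sub_self]
  obtain ⟨hxU, hxs, hxg⟩ := hball hx
  have hzero : ∀ g ∈ s', g.1 x = 0 := by
    intro g hg
    rw [hxs g hg]
    have h1 := hw _ (Finset.mem_insert_of_mem (Finset.mem_image_of_mem _ hg))
    rw [hrem] at h1
    have h2 : (∑ j ∈ Finset.range k, ι (C g j) * z ^ j).1 x = 0 := by
      rw [← h1, AddSubmonoidClass.coe_finsetSum, Finset.sum_apply]
      rfl
    rw [AddMemClass.coe_add, MulMemClass.coe_mul, Pi.add_apply, Pi.mul_apply, hΩx, mul_zero,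
      zero_add, h2]
  refine ⟨x, hxU, fun g hg => hzero g (Finset.mem_insert_of_mem hg), fun hfx => htg ?_⟩
  have h1 : (ι g).1 x = g.1 t := rfl
  rw [← h1, hxg, AddMemClass.coe_add, MulMemClass.coe_mul, Pi.add_apply, Pi.mul_apply, hfx,
    mul_zero, add_zero]
  exact hzero b (Finset.mem_insert_self _ _)

/-- Pick a point with `W x ≠ 0` in a ball of analyticity; by the identity theorem on the disc cut
out by the line through `x`, `W` cannot vanish near `0` on that line. -/
theorem exists_line_not_eventually_zero {E : Type*} [NormedAddCommGroup E] [NormedSpace ℂ E]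
    {W : E → ℂ} (hW : AnalyticAt ℂ W 0) (hne : ¬ ∀ᶠ x in 𝓝 0, W x = 0) :
    ∃ x, W x ≠ 0 ∧ ¬ ∀ᶠ z : ℂ in 𝓝 0, W (z • x) = 0 := by
  obtain ⟨ρ, hρ, hball⟩ := Metric.eventually_nhds_iff_ball.1 hW.eventually_analyticAt
  obtain ⟨x, hx, hxρ⟩ := ((not_eventually.1 hne).and_eventually
    (eventually_mem_set.2 (Metric.ball_mem_nhds 0 hρ))).exists
  refine ⟨x, hx, fun h => hx ?_⟩
  let l : ℂ →L[ℂ] E := ContinuousLinearMap.toSpanSingleton ℂ x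
  have hconv : Convex ℝ (l ⁻¹' Metric.ball 0 ρ) :=
    (convex_ball 0 ρ).linear_preimage (l.restrictScalars ℝ).toLinearMap
  have han : AnalyticOnNhd ℂ (fun z => W (l z)) (l ⁻¹' Metric.ball 0 ρ) := fun z hz =>
    AnalyticAt.comp_of_eq (hball _ hz) (l.analyticAt z) rfl
  have := han.eqOn_zero_of_preconnected_of_eventuallyEq_zero hconv.isPreconnected (z₀ := 0)
    (by simpa using hρ) h (x := 1) (by simpa [l] using hxρ)
  simpa [l] using this

theorem eval_zero_of_mem {d : ℕ} {P : Ideal (𝒪 d)} [hP : P.IsPrime] {W : AnFun d}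
    (hW : germHom d W ∈ P) : W.1 0 = 0 := by
  by_contra h
  exact hP.ne_top (Ideal.eq_top_of_isUnit_mem _ hW (isUnit_germHom h))

theorem exists_equiv_monic {d : ℕ} (P : Ideal (𝒪 (d + 1))) [P.IsPrime] (hP : P ≠ ⊥) :
    ∃ (L : (Fin (d + 1) → ℂ) ≃L[ℂ] (Fin (d + 1) → ℂ)) (k : ℕ) (W : AnFun (d + 1)),
      pullbackHom L.symm.toLinearMap (germHom _ W) ∈ P ∧
      ∀ᶠ z in 𝓝 0, W.1 (Fin.cons z 0) = z ^ k := by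
  obtain ⟨w, hwP, hw0⟩ := Submodule.exists_mem_ne_zero_of_ne_bot hP
  obtain ⟨W, rfl⟩ := germHom_surjective _ w
  have hne : ¬ ∀ᶠ x in 𝓝 0, W.1 x = 0 := fun h =>
    hw0 (by rw [← map_zero (germHom (d + 1)), germHom_eq_iff]; exact h)
  obtain ⟨x, hx, hline⟩ := exists_line_not_eventually_zero W.2 hne
  have hx0 : x ≠ 0 := by
    rintro rfl
    exact hx (eval_zero_of_mem hwP)
  obtain ⟨L, hL⟩ := SeparatingDual.exists_continuousLinearEquiv_apply_eq (R := ℂ)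
    (x := (Pi.single 0 1 : Fin (d + 1) → ℂ)) (y := x) (by simp) hx0
  have hLz : ∀ z : ℂ, L (Fin.cons z 0) = z • x := by
    intro z
    rw [← hL, ← map_smul]
    congr 1
    ext i
    refine Fin.cases ?_ (fun i => ?_) i <;> simp
  have han : AnalyticAt ℂ (fun z : ℂ => W.1 (z • x)) 0 :=
    AnalyticAt.comp_of_eq (g := W.1) W.2
      ((ContinuousLinearMap.toSpanSingleton ℂ x).analyticAt 0) (by simp)
  obtain ⟨k, u, hu, hu0, hk⟩ := han.exists_eventuallyEq_pow_smul_nonzero_iff.2 hline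
  -- On the chosen line `W` is `z ^ k * u z`; dividing by the unit `u` of the first coordinate makes
  -- the restriction exactly `z ^ k`.
  let U : AnFun (d + 1) := ⟨fun y => (u (y 0))⁻¹,
    AnalyticAt.inv (AnalyticAt.comp_of_eq hu (firstCoord d).2 rfl) hu0⟩
  refine ⟨L, k, compHom L.toLinearMap W * U, ?_, ?_⟩
  · rw [map_mul, map_mul]
    refine P.mul_mem_right _ ?_
    have : pullbackHom L.symm.toLinearMap (germHom _ (compHom L.toLinearMap W)) =
        germHom _ W := by
      rw [pullbackHom_germHom, germHom_eq_iff]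
      refine Eventually.of_forall fun y => ?_
      change W.1 (L (L.symm y)) = W.1 y
      rw [L.apply_symm_apply]
    rwa [this]
  · filter_upwards [hk, hu.continuousAt.eventually_ne hu0] with z h1 h2
    change W.1 (L (Fin.cons z 0)) * (u z)⁻¹ = z ^ k
    rw [hLz, h1, sub_zero, smul_eq_mul, mul_assoc, mul_inv_cancel₀ h2, mul_one]

theorem hasPoints (d : ℕ) : HasPoints d := by
  classical
  induction d with
  | zero =>
    intro P _ f hf s hs
    have h0 : f.1 0 ≠ 0 := by
      intro h
      refine hf ?_
      have : germHom 0 f = 0 := by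
        rw [← map_zero (germHom 0), germHom_eq_iff]
        refine Eventually.of_forall fun x => ?_
        rw [Subsingleton.elim x 0, h]
        rfl
      rw [this]
      exact P.zero_mem
    exact Eventually.frequently (Eventually.of_forall fun x => by
      rw [Subsingleton.elim x 0]
      exact ⟨fun g hg => eval_zero_of_mem (hs g hg), h0⟩)
  | succ d ih =>
    intro P _ f hf s hs
    by_cases hP : P = ⊥
    · subst hP
      have h1 : ∃ᶠ x in 𝓝 0, f.1 x ≠ 0 := not_eventually.1 fun h => hf (by
        rw [Ideal.mem_bot, ← map_zero (germHom (d + 1)), germHom_eq_iff]; exact h)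
      have h2 : ∀ᶠ x in 𝓝 0, ∀ g ∈ s, g.1 x = 0 := by
        rw [Filter.eventually_all_finset]
        intro g hg
        have := hs g hg
        rwa [Ideal.mem_bot, ← map_zero (germHom (d + 1)), germHom_eq_iff] at this
      exact (h1.and_eventually h2).mono fun x hx => hx.symm
    obtain ⟨L, k, W, hWP, hW0⟩ := exists_equiv_monic P hP
    have hL : ∀ F : AnFun (d + 1),
        pullbackHom L.symm.toLinearMap (germHom _ (compHom L.toLinearMap F)) = germHom _ F := by
      intro F
      rw [pullbackHom_germHom, germHom_eq_iff]
      refine Eventually.of_forall fun y => ?_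
      change F.1 (L (L.symm y)) = F.1 y
      rw [L.apply_symm_apply]
    have h := frequently_of_monic ih (P.comap (pullbackHom L.symm.toLinearMap)) hWP hW0
      (compHom L.toLinearMap f) (by rwa [Ideal.mem_comap, hL])
      (s.image (compHom L.toLinearMap)) (by
        intro g hg
        obtain ⟨g, hgs, rfl⟩ := Finset.mem_image.1 hg
        rw [Ideal.mem_comap, hL]
        exact hs g hgs)
    refine (L.continuous.tendsto' 0 0 (map_zero L)).frequently (h.mono fun y hy => ⟨?_, hy.2⟩)
    exact fun g hg => hy.1 _ (Finset.mem_image_of_mem _ hg)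

/-- The Rückert Nullstellensatz: a germ that vanishes on the zero set of finitely many analytic
germs has a power in the ideal that they generate. -/
theorem mem_radical_of_eventually_vanishing {d : ℕ} (s : Finset (AnFun d)) (f : AnFun d)
    (h : ∀ᶠ x in 𝓝 0, (∀ g ∈ s, g.1 x = 0) → f.1 x = 0) :
    germHom d f ∈ (Ideal.span (germHom d '' s)).radical := by
  rw [Ideal.radical_eq_sInf, Submodule.mem_sInf]
  rintro P ⟨hsP, hP⟩
  by_contra hf
  obtain ⟨x, ⟨h1, h2⟩, h3⟩ := ((hasPoints d P f hf s fun g hg =>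
    hsP (Ideal.subset_span ⟨g, hg, rfl⟩)).and_eventually h).exists
  exact h2 (h3 h1)

/-! ### Vector fields, Leibniz rule and pull-back -/

theorem pderiv_add {n : ℕ} (j : Fin n) (f g : 𝒪 n) : pderiv j (f + g) = pderiv j f + pderiv j g := by
  obtain ⟨F, rfl⟩ := germHom_surjective n f
  obtain ⟨G, rfl⟩ := germHom_surjective n g
  refine Subtype.ext (Germ.coe_eq.2 ?_)
  filter_upwards [F.2.eventually_analyticAt, G.2.eventually_analyticAt] with x hF hG
  exact DFunLike.congr_fun (fderiv_add hF.differentiableAt hG.differentiableAt) _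

theorem pderiv_mul {n : ℕ} (j : Fin n) (f g : 𝒪 n) :
    pderiv j (f * g) = f * pderiv j g + g * pderiv j f := by
  obtain ⟨F, rfl⟩ := germHom_surjective n f
  obtain ⟨G, rfl⟩ := germHom_surjective n g
  refine Subtype.ext (Germ.coe_eq.2 ?_)
  filter_upwards [F.2.eventually_analyticAt, G.2.eventually_analyticAt] with x hF hG
  exact DFunLike.congr_fun (fderiv_mul hF.differentiableAt hG.differentiableAt) _

theorem applyField_add {n : ℕ} (δ : Fin n → 𝒪 n) (f g : 𝒪 n) :
    applyField δ (f + g) = applyField δ f + applyField δ g := by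
  simp only [applyField, pderiv_add, mul_add, Finset.sum_add_distrib]

theorem applyField_mul {n : ℕ} (δ : Fin n → 𝒪 n) (f g : 𝒪 n) :
    applyField δ (f * g) = f * applyField δ g + g * applyField δ f := by
  simp only [applyField, pderiv_mul, mul_add, Finset.sum_add_distrib, Finset.mul_sum]
  congr 1 <;> exact Finset.sum_congr rfl fun _ _ => by ring

theorem pderiv_pullback {i n : ℕ} (p : (Fin i → ℂ) →ₗ[ℂ] (Fin n → ℂ)) (j : Fin i) (f : 𝒪 n) :
    pderiv j (pullback p f) = ∑ l, pullback p (pderiv l f) * jacobianEntry p l j := by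
  obtain ⟨F, rfl⟩ := germHom_surjective n f
  let p' : (Fin i → ℂ) →L[ℂ] (Fin n → ℂ) := LinearMap.toContinuousLinearMap p
  have key : ∀ᶠ x in 𝓝 (0 : Fin i → ℂ), fderiv ℂ (F.1 ∘ p) x (Pi.single j 1) =
      ∑ l, fderiv ℂ F.1 (p x) (Pi.single l 1) * p (Pi.single j 1) l := by
    filter_upwards [(tendsto_linearMap p).eventually F.2.eventually_analyticAt] with x hx
    have h1 : fderiv ℂ (F.1 ∘ p') x = (fderiv ℂ F.1 (p' x)).comp p' :=
      (hx.differentiableAt.hasFDerivAt.comp x p'.hasFDerivAt).fderiv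
    have h2 : p (Pi.single j 1) = ∑ l, p (Pi.single j 1) l • (Pi.single l 1 : Fin n → ℂ) := by
      ext l; simp [Finset.sum_apply, Pi.single_apply]
    calc fderiv ℂ (F.1 ∘ p) x (Pi.single j 1) = fderiv ℂ F.1 (p x) (p (Pi.single j 1)) :=
          DFunLike.congr_fun h1 _
      _ = _ := by
          conv_lhs => rw [h2]
          rw [map_sum]
          exact Finset.sum_congr rfl fun l _ => by rw [map_smul, smul_eq_mul, mul_comm]
  have hj : ∀ l, jacobianEntry p l j = toGerm (fun _ => p (Pi.single j 1) l) analyticAt_const := by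
    intro l
    refine Subtype.ext (Germ.coe_eq.2 (Eventually.of_forall fun x => ?_))
    exact DFunLike.congr_fun
      ((ContinuousLinearMap.proj (R := ℂ) (φ := fun _ : Fin n => ℂ) l ∘L p').hasFDerivAt
        (x := x)).fderiv _
  have hf : ∀ l, AnalyticAt ℂ (fun x => fderiv ℂ F.1 x (Pi.single l 1)) 0 := fun l =>
    F.2.fderiv.clm_apply_of_clm analyticAt_const
  have hsum : ∑ l, pullback p (pderiv l (germHom n F)) * jacobianEntry p l j = germHom i
      (∑ l, compHom p ⟨_, hf l⟩ * ⟨fun _ => p (Pi.single j 1) l, analyticAt_const⟩) := by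
    rw [map_sum]
    refine Finset.sum_congr rfl fun l _ => ?_
    rw [hj, map_mul]
    rfl
  rw [hsum]
  refine Subtype.ext (Germ.coe_eq.2 ?_)
  filter_upwards [key] with x hx
  rw [AddSubmonoidClass.coe_finsetSum, Finset.sum_apply]
  exact hx

theorem pullback_mem_vanishingIdeal {i n : ℕ} (p : (Fin i → ℂ) →ₗ[ℂ] (Fin n → ℂ))
    {X : Set (Fin n → ℂ)} {f : 𝒪 n} (hf : f ∈ vanishingIdeal X) :
    pullback p f ∈ vanishingIdeal (p ⁻¹' X) := by
  obtain ⟨F, hF, hX⟩ := hf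
  refine ⟨F ∘ p, ?_, (tendsto_linearMap p).eventually hX⟩
  change (F : Germ (𝓝 (0 : Fin n → ℂ)) ℂ).compTendsto p (tendsto_linearMap p) = _
  rw [hF]
  rfl

/-- The chain rule: a lift relation between `θ` and `η` intertwines the two derivations along `p`.
-/
theorem applyField_pullback {i n : ℕ} (p : (Fin i → ℂ) →ₗ[ℂ] (Fin n → ℂ)) {θ : Fin i → 𝒪 i}
    {η : Fin n → 𝒪 n} (hθ : ∀ l, ∑ j, jacobianEntry p l j * θ j = pullback p (η l)) (f : 𝒪 n) :
    applyField θ (pullback p f) = pullback p (applyField η f) := by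
  have h : pullback p (applyField η f) = ∑ l, pullback p (η l) * pullback p (pderiv l f) := by
    change pullbackHom p (∑ l, η l * pderiv l f) = _
    rw [map_sum]
    exact Finset.sum_congr rfl fun l _ => map_mul (pullbackHom p) _ _
  rw [h, applyField]
  simp only [← hθ, pderiv_pullback, Finset.mul_sum, Finset.sum_mul]
  rw [Finset.sum_comm]
  exact Finset.sum_congr rfl fun _ _ => Finset.sum_congr rfl fun _ _ => by ring

end AnalyticGerms

/-! ### Liftable fields preserve the ideal of the preimage -/

theorem mainTheorem6 {i n m : ℕ} (hn : 2 ≤ n) (hi : 1 ≤ i) (hin : i ≤ n - 1)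
    (X : Set (Fin n → ℂ)) (h : (Fin n → ℂ) → (Fin m → ℂ))
    (hh : AnalyticAt ℂ h 0) (hh0 : h 0 = 0)
    (hred : AnalyticGerms.IsReducedMap h hh)
    (hX : X =ᶠ[𝓝 0] (h ⁻¹' {0} : Set (Fin n → ℂ)))
    (p : (Fin i → ℂ) →ₗ[ℂ] (Fin n → ℂ))
    (hp : p ∈ AnalyticGerms.linearSections (hin.trans (Nat.sub_le n 1)))
    (hpred : AnalyticGerms.IsReducedMap (h ∘ p)
      (AnalyticGerms.analyticAt_comp_linearMap hh p)) :
    AnalyticGerms.Low X p ⊆ (AnalyticGerms.Theta (p ⁻¹' X) : Set (Fin i → AnalyticGerms.𝒪 i)) := by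
  classical
  open AnalyticGerms in
  rintro θ ⟨η, hη, hθ⟩ f hf
  have hX' : ∀ᶠ x in 𝓝 0, x ∈ X ↔ h x = 0 := hX.mono fun x hx => by
    exact iff_of_eq hx
  let c : Fin m → AnFun n := fun k => ⟨fun x => h x k, analyticAt_component hh k⟩
  have hcX : ∀ k, germHom n (c k) ∈ vanishingIdeal X := fun k =>
    ⟨(c k).1, rfl, hX'.mono fun x hx hxX => by
      change h x k = 0
      rw [hx.1 hxX]
      rfl⟩
  have hfJ : f ∈ Ideal.span (Set.range fun k => germHom i (compHom p (c k))) := by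
    refine hpred ?_
    obtain ⟨F, rfl⟩ := germHom_surjective i f
    obtain ⟨G, hGF, hG⟩ := hf
    have := mem_radical_of_eventually_vanishing (Finset.univ.image fun k => compHom p (c k)) F (by
      filter_upwards [(Germ.coe_eq.1 hGF : G =ᶠ[𝓝 0] F.1), hG,
        (tendsto_linearMap p).eventually hX'] with x h1 h2 h3 h4
      rw [← h1]
      refine h2 (h3.2 (funext fun k => ?_))
      exact h4 _ (Finset.mem_image_of_mem _ (Finset.mem_univ k)))
    rw [Finset.coe_image, Finset.coe_univ, Set.image_univ, ← Set.range_comp] at this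
    exact this
  -- Membership of `f` is carried through the induction because `θ(ab) = a θ(b) + b θ(a)` requires
  -- `b` itself to vanish on the preimage.
  suffices f ∈ vanishingIdeal (p ⁻¹' X) ∧ applyField θ f ∈ vanishingIdeal (p ⁻¹' X) from this.2
  refine Submodule.span_induction ?_ ?_ ?_ ?_ hfJ
  · rintro _ ⟨k, rfl⟩
    refine ⟨pullback_mem_vanishingIdeal p (hcX k), ?_⟩
    have := pullback_mem_vanishingIdeal p (hη _ (hcX k))
    rwa [← applyField_pullback p hθ] at this
  · refine ⟨Ideal.zero_mem _, ?_⟩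
    have : applyField θ 0 = 0 := by simpa using applyField_mul θ 0 0
    rw [this]
    exact Ideal.zero_mem _
  · rintro a b - - ⟨ha, ha'⟩ ⟨hb, hb'⟩
    rw [applyField_add]
    exact ⟨Ideal.add_mem _ ha hb, Ideal.add_mem _ ha' hb'⟩
  · rintro a b - ⟨hb, hb'⟩
    rw [smul_eq_mul, applyField_mul]
    exact ⟨Ideal.mul_mem_left _ _ hb,
      Ideal.add_mem _ (Ideal.mul_mem_left _ _ hb') (Ideal.mul_mem_right _ _ hb)⟩
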